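/- Let $\mathbb P$ be the set of all primes and, for $W\subseteq\mathbb P$, let $R_W=\mathbb Z[\tfrac1p : p\in W]\subseteq\mathbb Q$. For a subring $R\subseteq\mathbb Q$ let $\mathrm{HTP}(R)$ be the set of polynomials $f\in\mathbb Z[X_0,X_1,\ldots]$ that have a zero with all coordinates in $R$; it is viewed as a subset of $\omega$ through a fixed (arbitrary) computable bijection $\omega\to\mathbb Z[X_0,X_1,\ldots]$. Write $A\le_1 B$ via $\varphi$ if $\varphi:\omega\to\omega$ is a computable injection with $n\in A\iff\varphi(n)\in B$ for all $n$, and $A\le_1 B$ if there is such a $\varphi$. Subsets of $\mathbb P$ are identified with their characteristic functions, that is, with points of the product space $2^{\mathbb P}$. For a function $\sigma$ from a finite initial segment of $\mathbb P$ to $\{0,1\}$, let $\mathcal U_\sigma=\{W\subseteq\mathbb P : \sigma\subset W\}$ be the corresponding basic open set. Theorem. Let $C\subseteq\omega$. (1) If $C\not\le_1\mathrm{HTP}(\mathbb Q)$, then the class $\{W\subseteq\mathbb P : C\le_1\mathrm{HTP}(R_W)\}$ is meager in $2^{\mathbb P}$. (2) For every $\varphi:\omega\to\omega$ and every $\sigma$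 as above, if $\mathcal U_\sigma$ is contained in the closure of $\{W\subseteq\mathbb P : C\le_1\mathrm{HTP}(R_W)\text{ via }\varphi\}$, then $C\le_1\mathrm{HTP}(R_{\mathbb P-\sigma^{-1}(0)})$ via $\varphi$. -/

import Mathlib

/-- A polynomial with integer coefficients, written out as a finite list of terms: the pair
`(c, [i₁, …, i_k])` stands for the term `c · X_{i₁} ⋯ X_{i_k}`. -/
abbrev TermList : Type := List (ℤ × List ℕ)

/-- The polynomial in `ℤ[X₀, X₁, …]` that a list of terms denotes (the sum of its terms). -/
noncomputable def polyOfTerms (l : TermList) : MvPolynomial ℕ ℤ :=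
  (l.map fun t => MvPolynomial.C t.1 * (t.2.map MvPolynomial.X).prod).sum

/-- `e` is a computable bijection from `ω` onto `ℤ[X₀, X₁, …]`: from a code `n` one can compute
an explicit expression of the polynomial `e n`, and from an explicit expression of a polynomial
one can compute its code. (Each of the two clauses implies the other one, by a search.) -/
def IsComputableNumbering (e : ℕ ≃ MvPolynomial ℕ ℤ) : Prop :=
  (∃ g : ℕ → TermList, Computable g ∧ ∀ n, polyOfTerms (g n) = e n) ∧
    Computable fun l : TermList => e.symm (polyOfTerms l)

/-- Hilbert's Tenth Problem for `R`: the polynomials over `ℤ` in `X₀, X₁, …` that have a zero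
with coordinates in `R`. -/
def HTP (R : Type*) [CommRing R] : Set (MvPolynomial ℕ ℤ) :=
  {f | ∃ x : ℕ → R, MvPolynomial.aeval x f = 0}

/-- `HTP(R)` viewed as a set of natural numbers, through the numbering `e` of polynomials. -/
def HTPCodes (e : ℕ ≃ MvPolynomial ℕ ℤ) (R : Type*) [CommRing R] : Set ℕ :=
  {n | e n ∈ HTP R}

/-- The subring `R_W = ℤ[1/p : p ∈ W]` of the field of rational numbers. -/
def primeInvRing (W : Set Nat.Primes) : Subring ℚ :=
  Subring.closure {q | ∃ p ∈ W, q = 1 / ((p : ℕ) : ℚ)}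

/-- The space `2^ℙ` of all sets of primes, as characteristic functions; it carries the product
topology of the discrete space `{false, true}`. -/
abbrev PrimeSetSpace : Type := Nat.Primes → Bool

/-- The set of primes with characteristic function `W`. -/
def primeSet (W : PrimeSetSpace) : Set Nat.Primes :=
  {p | W p = true}

/-- The `i`-th prime `p_i`, starting with `p₀ = 2`. -/
noncomputable def nthPrime (i : ℕ) : Nat.Primes :=
  ⟨Nat.nth Nat.Prime i, Nat.prime_nth_prime i⟩

/-- The basic open set `𝒰_σ` of all `W` that extend the node `σ ∈ 2^{<ℙ}`, where `σ` is given as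
the finite sequence of its values at `p₀, p₁, …`. -/
def cylinder (σ : List Bool) : Set PrimeSetSpace :=
  {W | ∀ i (h : i < σ.length), W (nthPrime i) = σ[i]}

/-- The finite set `σ⁻¹(0)` of the primes that the node `σ` excludes. -/
def excludedPrimes (σ : List Bool) : Set Nat.Primes :=
  {p | ∃ i, ∃ h : i < σ.length, p = nthPrime i ∧ σ[i] = false}

/-- `φ` is a 1-reduction from `A` to `B`; the existence of such a `φ` is 1-reducibility, in the form
of Mathlib's `OneOneReducible`. -/
def IsOneReduction (φ : ℕ → ℕ) (A B : Set ℕ) : Prop :=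
  Computable φ ∧ Function.Injective φ ∧ ∀ n, n ∈ A ↔ φ n ∈ B

/-! Computable numberings of `ℤ[X₀, X₁, …]` exist. -/

namespace NumberingExists

/-- Coefficient of the monomial `m` in a list of terms, positive part. -/
def posSum (l : TermList) (m : List ℕ) : ℕ :=
  ((l.filter fun t => t.2.Perm m).map fun t => t.1.toNat).sum

/-- Coefficient of the monomial `m` in a list of terms, negative part. -/
def negSum (l : TermList) (m : List ℕ) : ℕ :=
  ((l.filter fun t => t.2.Perm m).map fun t => (-t.1).toNat).sum

theorem prod_X (m : List ℕ) : (m.map MvPolynomial.X).prod =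
    MvPolynomial.monomial (Multiset.toFinsupp (m : Multiset ℕ)) (1 : ℤ) := by
  induction m with
  | nil => simp
  | cons a m ih =>
    have : ((a :: m : List ℕ) : Multiset ℕ) = {a} + (m : Multiset ℕ) := rfl
    rw [this, map_add, List.map_cons, List.prod_cons, ih, MvPolynomial.X,
      MvPolynomial.monomial_mul, Multiset.toFinsupp_singleton, one_mul]

theorem coeff_poly (l : TermList) (m : List ℕ) :
    (polyOfTerms l).coeff (Multiset.toFinsupp (m : Multiset ℕ)) =
      (posSum l m : ℤ) - negSum l m := by
  induction l with
  | nil => simp [polyOfTerms, posSum, negSum]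
  | cons t l ih =>
    have h : polyOfTerms (t :: l) =
        MvPolynomial.C t.1 * (t.2.map MvPolynomial.X).prod + polyOfTerms l := by
      simp [polyOfTerms]
    rw [h, MvPolynomial.coeff_add, ih, prod_X, MvPolynomial.coeff_C_mul,
      MvPolynomial.coeff_monomial]
    simp only [EmbeddingLike.apply_eq_iff_eq, Multiset.coe_eq_coe]
    by_cases hp : t.2.Perm m
    · simp only [posSum, negSum, List.filter_cons, hp, if_true, decide_true, List.map_cons,
        List.sum_cons]
      push_cast
      have := Int.toNat_sub_toNat_neg t.1
      linarith
    · simp [posSum, negSum, hp]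

theorem poly_eq_iff (l l' : TermList) : polyOfTerms l = polyOfTerms l' ↔
    ∀ t ∈ l ++ l', posSum l t.2 + negSum l' t.2 = posSum l' t.2 + negSum l t.2 := by
  constructor
  · intro h t _
    have h1 := coeff_poly l t.2
    have h2 := coeff_poly l' t.2
    rw [h] at h1
    omega
  · intro h
    ext s
    obtain ⟨m, rfl⟩ := Multiset.toFinsupp.surjective s
    obtain ⟨m, rfl⟩ := Quot.exists_rep m
    change (polyOfTerms l).coeff (Multiset.toFinsupp (m : Multiset ℕ)) =
      (polyOfTerms l').coeff (Multiset.toFinsupp (m : Multiset ℕ))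
    by_cases hm : ∃ t ∈ l ++ l', t.2.Perm m
    · obtain ⟨t, ht, hp⟩ := hm
      have := h t ht
      rw [← Multiset.coe_eq_coe.2 hp, coeff_poly, coeff_poly]
      omega
    · push Not at hm
      have h0 : ∀ k : TermList, (∀ t ∈ k, ¬ t.2.Perm m) → posSum k m = 0 ∧ negSum k m = 0 := by
        intro k hk
        have : (k.filter fun t => t.2.Perm m) = [] := by
          simpa [List.filter_eq_nil_iff] using fun a b hab => hk (a, b) hab
        simp [posSum, negSum, this]
      have h1 := h0 l fun t ht => hm t (by simp [ht])
      have h2 := h0 l' fun t ht => hm t (by simp [ht])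
      rw [coeff_poly, coeff_poly, h1.1, h1.2, h2.1, h2.2]

theorem poly_surjective : Function.Surjective polyOfTerms := by
  intro p
  induction p using MvPolynomial.induction_on' with
  | monomial u a =>
    obtain ⟨m, rfl⟩ := Multiset.toFinsupp.surjective u
    obtain ⟨m, rfl⟩ := Quot.exists_rep m
    refine ⟨[(a, m)], ?_⟩
    have : polyOfTerms [(a, m)] =
        MvPolynomial.C a * (m.map MvPolynomial.X).prod := by simp [polyOfTerms]
    rw [this, prod_X, MvPolynomial.C_mul_monomial, mul_one]
    rfl
  | add p q hp hq =>
    obtain ⟨l, rfl⟩ := hp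
    obtain ⟨k, rfl⟩ := hq
    exact ⟨l ++ k, by simp [polyOfTerms]⟩

theorem primrec_toNat : Primrec Int.toNat := by
  have h : Primrec fun z : ℤ => if Encodable.encode z % 2 = 0 then Encodable.encode z / 2 else 0 :=
    Primrec.ite (Primrec.eq.comp (Primrec.nat_mod.comp Primrec.encode (Primrec.const 2))
      (Primrec.const 0)) (Primrec.nat_div.comp Primrec.encode (Primrec.const 2)) (Primrec.const 0)
  refine h.of_eq fun z => ?_
  rcases z with n | n
  · have : Encodable.encode (Int.ofNat n) = 2 * n := rfl
    rw [this]; simp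
  · have : Encodable.encode (Int.negSucc n) = 2 * n + 1 := rfl
    rw [this]; simp [Nat.add_mod]

theorem primrec_neg_toNat : Primrec fun z : ℤ => (-z).toNat := by
  have h : Primrec fun z : ℤ =>
      if Encodable.encode z % 2 = 0 then 0 else (Encodable.encode z + 1) / 2 :=
    Primrec.ite (Primrec.eq.comp (Primrec.nat_mod.comp Primrec.encode (Primrec.const 2))
      (Primrec.const 0)) (Primrec.const 0)
      (Primrec.nat_div.comp (Primrec.succ.comp Primrec.encode) (Primrec.const 2))
  refine h.of_eq fun z => ?_
  rcases z with n | n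
  · have : Encodable.encode (Int.ofNat n) = 2 * n := rfl
    rw [this]; simp
  · have : Encodable.encode (Int.negSucc n) = 2 * n + 1 := rfl
    rw [this, if_neg (by omega)]
    have : -(Int.negSucc n) = ((n + 1 : ℕ) : ℤ) := by simp [Int.negSucc_eq]
    rw [this, Int.toNat_natCast]
    omega

theorem primrec_sum : Primrec (List.sum : List ℕ → ℕ) := by
  have h : Primrec fun l : List ℕ => l.foldr (fun a s => a + s) 0 :=
    Primrec.list_foldr Primrec.id (Primrec.const 0)
      (Primrec.nat_add.comp (Primrec.fst.comp Primrec.snd) (Primrec.snd.comp Primrec.snd)).to₂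
  exact h

theorem primrecRel_perm : PrimrecRel fun m m' : List ℕ => m.Perm m' := by
  have hc : Primrec₂ fun (m : List ℕ) (a : ℕ) => (m.filter fun b => b = a).length :=
    (Primrec.list_length.comp₂ (PrimrecRel.listFilter (Primrec.eq (α := ℕ))))
  have hr : PrimrecRel fun (a : ℕ) (p : List ℕ × List ℕ) =>
      (p.1.filter fun b => b = a).length = (p.2.filter fun b => b = a).length :=
    Primrec.eq.comp (hc.comp (Primrec.fst.comp Primrec.snd) Primrec.fst)
      (hc.comp (Primrec.snd.comp Primrec.snd) Primrec.fst)
  have h := (PrimrecRel.forall_mem_list hr).comp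
    (Primrec.list_append.comp Primrec.fst Primrec.snd) (Primrec.id (α := List ℕ × List ℕ))
  refine PrimrecPred.of_eq h fun p => ?_
  have e : ∀ (m : List ℕ) a, (m.filter fun b => b = a).length = m.count a := by
    intro m a
    rw [List.count_eq_length_filter]
    rfl
  simp only [e, id]
  rw [List.perm_iff_count]
  refine ⟨fun h a => ?_, fun h a _ => h a⟩
  by_cases ha : a ∈ p.1 ++ p.2
  · exact h a ha
  · rw [List.mem_append, not_or] at ha
    rw [List.count_eq_zero_of_not_mem ha.1, List.count_eq_zero_of_not_mem ha.2]

theorem primrec_filter : Primrec₂ fun (l : TermList) (m : List ℕ) =>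
    l.filter fun t => t.2.Perm m :=
  PrimrecRel.listFilter (R := fun (t : ℤ × List ℕ) (m : List ℕ) => t.2.Perm m)
    (primrecRel_perm.comp (Primrec.snd.comp Primrec.fst) Primrec.snd)

theorem primrec_posSum : Primrec₂ posSum :=
  primrec_sum.comp₂ (Primrec.list_map primrec_filter
    (primrec_toNat.comp (Primrec.fst.comp Primrec.snd)).to₂)

theorem primrec_negSum : Primrec₂ negSum :=
  primrec_sum.comp₂ (Primrec.list_map primrec_filter
    (primrec_neg_toNat.comp (Primrec.fst.comp Primrec.snd)).to₂)

theorem primrecRel_poly_eq : PrimrecRel fun l l' : TermList => polyOfTerms l = polyOfTerms l' := by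
  have hr : PrimrecRel fun (t : ℤ × List ℕ) (p : TermList × TermList) =>
      posSum p.1 t.2 + negSum p.2 t.2 = posSum p.2 t.2 + negSum p.1 t.2 := by
    have a1 := Primrec.fst.comp (Primrec.snd (α := ℤ × List ℕ) (β := TermList × TermList))
    have a2 := Primrec.snd.comp (Primrec.snd (α := ℤ × List ℕ) (β := TermList × TermList))
    have b := Primrec.snd.comp (Primrec.fst (α := ℤ × List ℕ) (β := TermList × TermList))
    exact Primrec.eq.comp
      (Primrec.nat_add.comp (primrec_posSum.comp a1 b) (primrec_negSum.comp a2 b))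
      (Primrec.nat_add.comp (primrec_posSum.comp a2 b) (primrec_negSum.comp a1 b))
  have h := (PrimrecRel.forall_mem_list hr).comp
    (Primrec.list_append.comp Primrec.fst Primrec.snd) (Primrec.id (α := TermList × TermList))
  exact PrimrecPred.of_eq h fun p => (poly_eq_iff p.1 p.2).symm

theorem primrec_count {p : ℕ → Prop} [DecidablePred p] (hp : PrimrecPred p) :
    Primrec (Nat.count p) := by
  have h : Primrec fun n : ℕ => ((List.range n).filter (p ·)).length :=
    Primrec.list_length.comp ((Primrec.listFilter hp).comp Primrec.list_range)
  refine h.of_eq fun n => ?_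
  rw [Nat.count, List.countP_eq_length_filter]

/-- A surjection from `ℕ` onto an infinite set with a primitive recursive kernel can be turned
into a bijection. -/
theorem exists_equiv {A : Type*} [Infinite A] (D : ℕ → A) (hD : Function.Surjective D)
    (hk : PrimrecRel fun m n => D m = D n) :
    ∃ e : ℕ ≃ A, Computable fun n => e.symm (D n) := by
  classical
  let S : ℕ → Prop := fun n => ∀ m < n, ¬ D m = D n
  have hS : PrimrecPred S := by
    have h1 : PrimrecRel fun m n : ℕ => ¬ D m = D n := hk.not
    exact (PrimrecRel.forall_lt h1).comp Primrec.id Primrec.id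
  have hex : ∀ n, ∃ m, D m = D n := fun n => ⟨n, rfl⟩
  let r : ℕ → ℕ := fun n => Nat.find (hex n)
  have hr : ∀ n, D (r n) = D n := fun n => Nat.find_spec (hex n)
  have hrS : ∀ n, S (r n) := fun n m hm h => Nat.find_min (hex n) hm (h.trans (hr n))
  have hrr : ∀ n, S n → r n = n := fun n hn =>
    le_antisymm (Nat.find_min' (hex n) rfl)
      (not_lt.1 fun h => hn _ h (hr n))
  have hreq : ∀ m n, D m = D n → r m = r n := by
    intro m n h
    simp only [r, h]
  have hinf : {n | S n}.Infinite := by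
    intro hfin
    have : (Set.univ : Set A).Finite := by
      refine (hfin.image D).subset fun a _ => ?_
      obtain ⟨n, rfl⟩ := hD a
      exact ⟨r n, hrS n, hr n⟩
    exact Set.infinite_univ this
  have hrc : Computable r := by
    have hp : Computable₂ fun n m : ℕ => decide (D m = D n) :=
      (hk.comp Primrec.snd Primrec.fst).decide.to_comp
    refine Partrec.of_eq_tot (Partrec.rfind hp.partrec₂) fun n => ?_
    rw [Nat.mem_rfind]
    refine ⟨?_, fun {m} hm => ?_⟩
    · simpa using hr n
    · simpa using Nat.find_min (hex n) hm
  let f : ℕ → ℕ := fun n => Nat.count S (r n)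
  have hf : Computable f := (primrec_count hS).to_comp.comp hrc
  have hfD : ∀ m n, f m = f n ↔ D m = D n := fun m n =>
    ⟨fun h => by rw [← hr m, ← hr n, Nat.count_injective (hrS m) (hrS n) h],
      fun h => by simp only [f, hreq m n h]⟩
  have hfs : Function.Surjective f := fun n => by
    have h := Nat.nth_mem_of_infinite hinf n
    exact ⟨Nat.nth S n, by simp only [f, hrr _ h, Nat.count_nth_of_infinite hinf]⟩
  let k : A → ℕ := fun a => f (Function.surjInv hD a)
  have hkD : ∀ n, k (D n) = f n := fun n => (hfD _ _).2 (Function.surjInv_eq hD _)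
  have hkb : Function.Bijective k := by
    refine ⟨fun a b h => ?_, fun n => ?_⟩
    · have := (hfD _ _).1 h
      rwa [Function.surjInv_eq hD, Function.surjInv_eq hD] at this
    · obtain ⟨m, rfl⟩ := hfs n
      exact ⟨D m, hkD m⟩
  refine ⟨(Equiv.ofBijective k hkb).symm, ?_⟩
  exact hf.of_eq fun n => by simp [hkD]

end NumberingExists

theorem exists_isComputableNumbering :
    ∃ e : ℕ ≃ MvPolynomial ℕ ℤ, IsComputableNumbering e := by
  obtain ⟨e, he⟩ := NumberingExists.exists_equiv
    (fun n => polyOfTerms (Denumerable.ofNat TermList n))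
    (fun p => by
      obtain ⟨l, rfl⟩ := NumberingExists.poly_surjective p
      exact ⟨Encodable.encode l, by simp⟩)
    (NumberingExists.primrecRel_poly_eq.comp
      ((Primrec.ofNat TermList).comp Primrec.fst) ((Primrec.ofNat TermList).comp Primrec.snd))
  have he' : Computable fun l : TermList => e.symm (polyOfTerms l) :=
    (he.comp Computable.encode).of_eq fun l => by simp
  refine ⟨e, ?_, he'⟩
  classical
  have hp : Computable₂ fun n k : ℕ =>
      decide (e.symm (polyOfTerms (Denumerable.ofNat TermList k)) = n) :=
    (Primrec.eq (α := ℕ)).decide.to_comp.comp (he.comp Computable.snd) Computable.fst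
  have hex : ∀ n, ∃ k, e.symm (polyOfTerms (Denumerable.ofNat TermList k)) = n := fun n => by
    obtain ⟨l, hl⟩ := NumberingExists.poly_surjective (e n)
    exact ⟨Encodable.encode l, by simp [hl]⟩
  have hs : Computable fun n => Nat.find (hex n) := by
    refine Partrec.of_eq_tot (Partrec.rfind hp.partrec₂) fun n => ?_
    rw [Nat.mem_rfind]
    refine ⟨?_, fun {m} hm => ?_⟩
    · simpa using Nat.find_spec (hex n)
    · simpa using Nat.find_min (hex n) hm
  refine ⟨fun n => Denumerable.ofNat TermList (Nat.find (hex n)),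
    (Computable.ofNat TermList).comp hs, fun n => ?_⟩
  have := Nat.find_spec (hex n)
  rwa [Equiv.symm_apply_eq] at this

/-! For (2), any `W` in the cylinder omits the excluded primes, so `R_W` lies in the ring for the
cofinite set, which gives one direction of the reduction by monotonicity. For the other, a zero has
only finitely many relevant coordinates and so uses finitely many inverted primes. Density yields a
`W` in the cylinder that contains these primes and reduces `C` via `φ`. This is
`isOneReduction_of_cylinder_subset_closure`.

For (1), the class is a union of countably many pieces, one for each computable `φ`. If a piece were
not nowhere dense, its closure would contain a cylinder, and (2) would reduce `C` to HTP of a ring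
that inverts all but finitely many primes. Such a ring is Diophantine in `ℚ`
(`isDiophantineSet_primeInvRing`), so its HTP is 1-reducible to that of `ℚ`
(`oneOneReducible_HTPCodes`), against the hypothesis on `C`.

The arithmetic content is that p-integrality is existentially definable in `ℚ` (`not_dvd_den_iff`).
Take the norm form of a quaternion algebra `(s, p)` that is anisotropic over `ℚ_p`. The last
coordinates of its rational vectors of norm 1 have p-adic valuation at least -1
(`exists_eq_div_of_mem_normOneCoord`). On the other hand they include every multiple of 4 in `ℤ`
(`intCast_mem_normOneCoord`), by a global argument from Legendre's theorem, Dirichlet's theorem and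
quadratic reciprocity. A quotient of such numbers, with fourth powers absorbing the bounded loss,
then defines p-integrality exactly. -/

/-! ### Legendre's theorem for a x² + l y² = c z² -/

theorem sq_ne_mul_prime {l : ℕ} (hl : l.Prime) {m : ℕ} (hm : ¬ l ∣ m) (w : ℤ) :
    w ^ 2 ≠ m * l := by
  intro h
  have hlp : Prime (l : ℤ) := Nat.prime_iff_prime_int.1 hl
  have : (l : ℤ) ∣ w := hlp.dvd_of_dvd_pow (h ▸ Dvd.intro_left _ rfl)
  obtain ⟨k, rfl⟩ := this
  have : (l : ℤ) * k ^ 2 = m := by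
    apply mul_left_cancel₀ hlp.ne_zero; linear_combination h
  exact hm (by exact_mod_cast Dvd.intro _ this)

theorem eq_zero_of_prime_mul_sq_eq {l : ℕ} (hl : l.Prime) {m : ℕ} (hm : ¬ l ∣ m) {u v : ℤ}
    (h : (l : ℤ) * u ^ 2 = m * v ^ 2) : u = 0 ∧ v = 0 := by
  have hm0 : (m : ℤ) ≠ 0 := by rintro h0; exact hm (by simp [Int.natCast_eq_zero.1 h0])
  have hu : u = 0 := by
    by_contra hu
    have : u ^ 2 ∣ (m * v) ^ 2 := ⟨m * l, by linear_combination -m * h⟩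
    obtain ⟨k, hk⟩ := (Int.pow_dvd_pow_iff two_ne_zero).1 this
    apply sq_ne_mul_prime hl hm k
    apply mul_left_cancel₀ (pow_ne_zero 2 hu)
    linear_combination -(m * v + u * k) * hk - m * h
  subst hu
  refine ⟨rfl, ?_⟩
  have : (m : ℤ) * v ^ 2 = 0 := by rw [← h]; ring
  exact pow_eq_zero_iff two_ne_zero |>.1 ((mul_eq_zero.1 this).resolve_left hm0)

/-- A case of Legendre's theorem on ternary quadratic forms. -/
theorem exists_ternary_zero {a c l : ℕ} (ha : 0 < a) (hc : 0 < c) (hl : l.Prime)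
    (hac : a.Coprime c) (hla : ¬ l ∣ a) (hlc : ¬ l ∣ c) (h1 : (a : ℤ) ∣ l - c)
    (h2 : (c : ℤ) ∣ a + l) (h3 : IsSquare ((a * c : ℕ) : ZMod l)) :
    ∃ x y z : ℤ, (x ≠ 0 ∨ y ≠ 0 ∨ z ≠ 0) ∧ a * x ^ 2 + l * y ^ 2 = c * z ^ 2 := by
  have := Fact.mk hl
  have : NeZero a := ⟨ha.ne'⟩
  have : NeZero c := ⟨hc.ne'⟩
  have ha0 : (a : ZMod l) ≠ 0 := by rwa [Ne, ZMod.natCast_eq_zero_iff]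
  obtain ⟨r, hr⟩ := h3
  push_cast at hr
  have hα : (a : ZMod l) * (r / a) ^ 2 = c := by
    field_simp
    rw [hr, pow_two]
  obtain ⟨α, hα'⟩ := ZMod.intCast_surjective (r / (a : ZMod l))
  -- Pigeonhole: the box has more than `a * l * c` points, and `f` records the linear congruences
  -- modulo `a`, `l`, `c` under which the quadratic form splits and vanishes modulo each of them.
  let box := (Finset.range (Nat.sqrt (l * c) + 1)) ×ˢ (Finset.range (Nat.sqrt (a * c) + 1)) ×ˢ
    (Finset.range (Nat.sqrt (a * l) + 1))
  let f : ℕ × ℕ × ℕ → ZMod a × ZMod l × ZMod c := fun v =>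
    (v.2.1 - v.2.2, v.1 - r / a * v.2.2, v.1 - v.2.1)
  have hcard : (Finset.univ : Finset (ZMod a × ZMod l × ZMod c)).card < box.card := by
    simp only [Finset.card_univ, Fintype.card_prod, ZMod.card, box, Finset.card_product,
      Finset.card_range]
    have e1 := Nat.lt_succ_sqrt (l * c)
    have e2 := Nat.lt_succ_sqrt (a * c)
    have e3 := Nat.lt_succ_sqrt (a * l)
    have := Nat.mul_lt_mul'' e1 (Nat.mul_lt_mul'' e2 e3)
    refine lt_of_pow_lt_pow_left₀ 2 (Nat.zero_le _) ?_
    calc _ = l * c * (a * c * (a * l)) := by ring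
      _ < _ := this
      _ = _ := by simp only [Nat.succ_eq_add_one]; ring
  obtain ⟨u, hu, v, hv, huv, hf⟩ :=
    Finset.exists_ne_map_eq_of_card_lt_of_maps_to hcard (f := f) (fun _ _ => by simp)
  simp only [box, Finset.mem_product, Finset.mem_range, Nat.lt_succ_iff] at hu hv
  simp only [f, Prod.mk.injEq] at hf
  obtain ⟨f1, f2, f3⟩ := hf
  set x : ℤ := u.1 - v.1 with hx
  set y : ℤ := u.2.1 - v.2.1 with hy
  set z : ℤ := u.2.2 - v.2.2 with hz
  have g1 : (a : ℤ) ∣ y - z := by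
    rw [← ZMod.intCast_zmod_eq_zero_iff_dvd, hy, hz]; push_cast; linear_combination f1
  have g2 : (l : ℤ) ∣ x - α * z := by
    rw [← ZMod.intCast_zmod_eq_zero_iff_dvd, hx, hz]; push_cast; rw [hα']; linear_combination f2
  have g3 : (c : ℤ) ∣ x - y := by
    rw [← ZMod.intCast_zmod_eq_zero_iff_dvd, hx, hy]; push_cast; linear_combination f3
  have g4 : (l : ℤ) ∣ a * α ^ 2 - c := by
    rw [← ZMod.intCast_zmod_eq_zero_iff_dvd]; push_cast; rw [hα', hα]; ring
  have sq_le : ∀ (m i j : ℕ), i ≤ Nat.sqrt m → j ≤ Nat.sqrt m → ((i : ℤ) - j) ^ 2 ≤ m := by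
    intro m i j hi hj
    have : (Nat.sqrt m : ℤ) ^ 2 ≤ m := by exact_mod_cast Nat.sqrt_le' m
    have : |(i : ℤ) - j| ≤ |(Nat.sqrt m : ℤ)| := by
      rw [abs_of_nonneg (Int.natCast_nonneg (Nat.sqrt m)), abs_le]; constructor <;> omega
    have := sq_le_sq.2 this
    linarith
  have bx := sq_le _ _ _ hu.1 hv.1
  have by' := sq_le _ _ _ hu.2.1 hv.2.1
  have bz := sq_le _ _ _ hu.2.2 hv.2.2
  rw [← hx] at bx; rw [← hy] at by'; rw [← hz] at bz
  push_cast at bx by' bz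
  -- Strictness holds because `l * c` and `a * l` are not squares. The bound on `y` may be attained,
  -- as `a * c` can be a square; the other two suffice to confine `V` strictly between `-alc` and
  -- `2alc`.
  have bx' : x ^ 2 < l * c := lt_of_le_of_ne bx (by rw [mul_comm]; exact sq_ne_mul_prime hl hlc x)
  have bz' : z ^ 2 < a * l := lt_of_le_of_ne bz (sq_ne_mul_prime hl hla z)
  have haz : (0 : ℤ) < a := by exact_mod_cast ha
  have hcz : (0 : ℤ) < c := by exact_mod_cast hc
  have hlz : (0 : ℤ) < l := by exact_mod_cast hl.pos
  set V : ℤ := a * x ^ 2 + l * y ^ 2 - c * z ^ 2 with hV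
  have d1 : (a : ℤ) ∣ V := by
    obtain ⟨k, hk⟩ := g1
    obtain ⟨m, hm⟩ := h1
    refine ⟨x ^ 2 + l * k * (y + z) + m * z ^ 2, ?_⟩
    rw [hV]; linear_combination l * (y + z) * hk + z ^ 2 * hm
  have d2 : (l : ℤ) ∣ V := by
    obtain ⟨k, hk⟩ := g2
    obtain ⟨m, hm⟩ := g4
    refine ⟨y ^ 2 + a * k * (x + α * z) + m * z ^ 2, ?_⟩
    rw [hV]; linear_combination a * (x + α * z) * hk + z ^ 2 * hm
  have d3 : (c : ℤ) ∣ V := by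
    obtain ⟨k, hk⟩ := g3
    obtain ⟨m, hm⟩ := h2
    refine ⟨- z ^ 2 + a * k * (x + y) + m * y ^ 2, ?_⟩
    rw [hV]; linear_combination a * (x + y) * hk + y ^ 2 * hm
  have hdvd : ((a * l * c : ℕ) : ℤ) ∣ V := by
    have c1 : IsCoprime (a : ℤ) l := Nat.isCoprime_iff_coprime.2
      ((Nat.Prime.coprime_iff_not_dvd hl).2 hla).symm
    have c2 : IsCoprime (a : ℤ) c := Nat.isCoprime_iff_coprime.2 hac
    have c3 : IsCoprime (l : ℤ) c := Nat.isCoprime_iff_coprime.2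
      ((Nat.Prime.coprime_iff_not_dvd hl).2 hlc)
    push_cast
    exact (c2.mul_left c3).mul_dvd (c1.mul_dvd d1 d2) d3
  obtain ⟨k, hk⟩ := hdvd
  push_cast at hk
  have hxyz : x ≠ 0 ∨ y ≠ 0 ∨ z ≠ 0 := by
    by_contra! h
    apply huv
    ext <;> omega
  have hP : (0 : ℤ) < a * l * c := by positivity
  have up : V < 2 * (a * l * c) := by
    have := mul_lt_mul_of_pos_left bx' haz
    have := mul_le_mul_of_nonneg_left by' hlz.le
    have := mul_nonneg hcz.le (sq_nonneg z)
    rw [hV]; linarith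
  have lo : -(a * l * c) < V := by
    have := mul_lt_mul_of_pos_left bz' hcz
    have := mul_nonneg haz.le (sq_nonneg x)
    have := mul_nonneg hlz.le (sq_nonneg y)
    rw [hV]; linarith
  have k1 : k < 2 := by
    refine lt_of_mul_lt_mul_left ?_ hP.le
    rw [← hk]; linarith
  have k0 : -1 < k := by
    refine lt_of_mul_lt_mul_left ?_ hP.le
    rw [← hk]; linarith
  obtain rfl | rfl : k = 0 ∨ k = 1 := by omega
  · exact ⟨x, y, z, hxyz, by linarith⟩
  -- When `V = alc`, that is `a x² + l y² = c (z² + a l)`, the identity `a (xz + ly)² + l (yz - ax)²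
  -- = (a x² + l y²)(z² + a l)` produces a genuine zero.
  · refine ⟨x * z + l * y, y * z - a * x, z ^ 2 + a * l, Or.inr (Or.inr ?_), ?_⟩
    · have := mul_pos haz hlz
      have := sq_nonneg z
      exact (by linarith : 0 < z ^ 2 + a * l).ne'
    · linear_combination (z ^ 2 + a * l) * (hV.symm.trans hk)

/-! ### Multiples of 4 as coordinates of norm-one vectors -/

theorem isSquare_natCast_iff_jacobiSym_eq_one {l : ℕ} [Fact l.Prime] {m : ℕ} (hm : ¬ l ∣ m) :
    IsSquare (m : ZMod l) ↔ jacobiSym m l = 1 := by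
  rw [← jacobiSym.legendreSym.to_jacobiSym, legendreSym.eq_one_iff']
  rwa [Ne, ZMod.natCast_eq_zero_iff]

/-- `J(p | B) = 1` when `B ≡ -1` modulo `8 p`. -/
theorem jacobiSym_prime_eq_one {p B : ℕ} (hp : p.Prime) (h8 : 8 ∣ B + 1) (hpB : p ∣ B + 1) :
    jacobiSym p B = 1 := by
  have hB : Odd B := by rw [Nat.odd_iff]; omega
  rcases hp.eq_two_or_odd with rfl | ho
  · have := jacobiSym.at_two hB
    push_cast
    rw [this, ZMod.χ₈_nat_eq_if_mod_eight]
    have : B % 8 = 7 := by omega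
    simp [this]; omega
  · have hodd : Odd p := Nat.odd_iff.2 ho
    have e : jacobiSym B p = jacobiSym (-1) p := by
      apply jacobiSym.mod_left'
      rw [Int.emod_eq_emod_iff_emod_sub_eq_zero]
      apply Int.emod_eq_zero_of_dvd
      have := Int.natCast_dvd_natCast.2 hpB
      simpa using this
    rw [jacobiSym.at_neg_one hodd] at e
    have : p % 4 = 1 ∨ p % 4 = 3 := by omega
    rcases this with h | h
    · rw [jacobiSym.quadratic_reciprocity_one_mod_four h hB, e, ZMod.χ₄_nat_one_mod_four h]
    · rw [jacobiSym.quadratic_reciprocity_three_mod_four h (by omega), e,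
        ZMod.χ₄_nat_three_mod_four h]; norm_num

/-- The rationals `n` for which the norm form `x² - s y² - p (w² - s n²)` takes the value `1`. -/
def normOneCoord (p s : ℕ) : Set ℚ :=
  {n | ∃ x y w : ℚ, x ^ 2 - s * y ^ 2 - p * w ^ 2 + p * s * n ^ 2 = 1}

/-- The moduli `8 * s * p` and `B` are coprime because the first divides `B + 1`, so the Chinese
remainder theorem and Dirichlet's theorem apply. The first congruence will make `s` and `p` squares
modulo `l`, the second `B`; the size of `l` keeps it from dividing any of them. -/
theorem exists_auxiliary_prime {p s B : ℕ} (hp : p.Prime) (hs : s.Prime)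
    (hB0 : 0 < B) (hq : 8 * s * p ∣ B + 1) :
    ∃ l : ℕ, l.Prime ∧ s + p + B < l ∧ l ≡ 1 [MOD 8 * s * p] ∧ l ≡ p [MOD B] := by
  have cop : ∀ m, m ∣ B + 1 → m.Coprime B := fun m hm =>
    Nat.Coprime.coprime_dvd_left hm (by simp)
  have hco := cop _ hq
  obtain ⟨r, hr1, hr2⟩ := Nat.chineseRemainder hco 1 p
  have hr : r.Coprime (8 * s * p * B) := by
    refine Nat.Coprime.mul_right ?_ ?_
    · rw [Nat.Coprime, hr1.gcd_eq]; simp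
    · rw [Nat.Coprime, hr2.gcd_eq]; exact cop p ((Dvd.intro_left _ rfl).trans hq)
  have hne : 8 * s * p * B ≠ 0 := by
    have := hp.pos; have := hs.pos; positivity
  obtain ⟨l, hl, hlp, hlr⟩ := Nat.forall_exists_prime_gt_and_modEq (s + p + B) hne hr
  exact ⟨l, hlp, hl, (hlr.of_mul_right _).trans hr1, (hlr.of_mul_left _).trans hr2⟩

/-- With `B = p s n² - 1`, the task is to solve `x² - s y² = p w² - B`. It suffices that both sides
can equal `l` times a common nonzero square for some prime `l`: `l` is to be a norm from `ℚ(√s)`,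
and `B T² + l v² = p w²` is to be solvable. Both are instances of `exists_ternary_zero`.
Divisibility of `n` by 4 gives `8 s p ∣ B + 1`. -/
theorem natCast_mem_normOneCoord {p s : ℕ} (hp : p.Prime) (hs : s.Prime) (hs4 : s % 4 = 1)
    (hsp : s ≠ p) {n : ℕ} (hn : 4 ∣ n) (hn0 : 0 < n) : (n : ℚ) ∈ normOneCoord p s := by
  have hN : 0 < p * s * n ^ 2 := by have := hp.pos; have := hs.pos; positivity
  obtain ⟨B, hB⟩ : ∃ B, B + 1 = p * s * n ^ 2 := ⟨_, Nat.sub_add_cancel hN⟩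
  have hq : 8 * s * p ∣ B + 1 := by
    obtain ⟨k, rfl⟩ := hn
    exact ⟨2 * k ^ 2, by rw [hB]; ring⟩
  have h8 : 8 ∣ B + 1 := (Dvd.intro _ (mul_assoc 8 s p).symm).trans hq
  have hsB : s ∣ B + 1 := (Dvd.intro (8 * p) (by ring)).trans hq
  have hpB : p ∣ B + 1 := (Dvd.intro_left _ rfl).trans hq
  have hB0 : 0 < B := by omega
  obtain ⟨l, hl, hlt, hl1, hlB⟩ := exists_auxiliary_prime hp hs hB0 hq
  have := Fact.mk hl
  have := Fact.mk hp
  have := Fact.mk hs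
  have hl8 : l % 8 = 1 := hl1.of_dvd (Dvd.intro _ (mul_assoc 8 s p).symm)
  have hls : l ≡ 1 [MOD s] := hl1.of_dvd (Dvd.intro (8 * p) (by ring))
  have hlp : l ≡ 1 [MOD p] := hl1.of_dvd (Dvd.intro_left _ rfl)
  have nd : ∀ m, 0 < m → m ≤ s + p + B → ¬ l ∣ m := fun m h0 h h' => by
    have := Nat.le_of_dvd h0 h'; omega
  have nds := nd s hs.pos (by omega)
  have ndp := nd p hp.pos (by omega)
  have ndB := nd B hB0 (by omega)
  have cast_one : ∀ q : ℕ, l ≡ 1 [MOD q] → (l : ZMod q) = 1 := fun q h => by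
    simpa using (ZMod.natCast_eq_natCast_iff l 1 q).2 h
  have sqs : IsSquare (s : ZMod l) := by
    rw [← ZMod.exists_sq_eq_prime_iff_of_mod_four_eq_one hs4 (by rintro rfl; omega),
      cast_one s hls]
    exact IsSquare.one
  have sqp : IsSquare (p : ZMod l) := by
    by_cases h2 : p = 2
    · subst h2
      exact_mod_cast (ZMod.exists_sq_eq_two_iff (p := l) (by rintro rfl; omega)).2 (Or.inl hl8)
    · rw [ZMod.exists_sq_eq_prime_iff_of_mod_four_eq_one (by omega) h2, cast_one p hlp]
      exact IsSquare.one
  -- By reciprocity and `l ≡ p` modulo `B`: `(B/l) = (l/B) = (p/B) = 1`.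
  have sqB : IsSquare (B : ZMod l) := by
    rw [isSquare_natCast_iff_jacobiSym_eq_one ndB,
      ← jacobiSym.quadratic_reciprocity_one_mod_four (by omega) (by rw [Nat.odd_iff]; omega),
      ← jacobiSym_prime_eq_one hp h8 hpB]
    apply jacobiSym.mod_left'
    exact_mod_cast hlB
  obtain ⟨x, y, z, h1, h2⟩ := exists_ternary_zero hs.pos one_pos hl (Nat.coprime_one_right s) nds
    (fun h => hl.one_lt.ne' (Nat.dvd_one.1 h)) (Nat.modEq_iff_dvd.1 hls.symm) (by simp) (by simpa using sqs)
  obtain ⟨T, v, w, h3, h4⟩ := exists_ternary_zero hB0 hp.pos hl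
    (Nat.Coprime.coprime_dvd_left hpB (by simp)).symm ndB ndp (Nat.modEq_iff_dvd.1 hlB.symm)
    (by
      have a := Int.natCast_dvd_natCast.2 hpB
      have b := Nat.modEq_iff_dvd.1 hlp.symm
      push_cast at a b
      exact (by ring : (B : ℤ) + l = (B + 1) + (l - 1)) ▸ dvd_add a b)
    (by push_cast; exact sqB.mul sqp)
  have hpnB : ¬ p ∣ B := fun h => hp.one_lt.ne' (Nat.dvd_one.1 ((Nat.dvd_add_right h).1 hpB))
  have hy : y ≠ 0 := by
    rintro rfl
    have := eq_zero_of_prime_mul_sq_eq hs (m := 1) (u := x) (v := z)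
      (fun h => hs.one_lt.ne' (Nat.dvd_one.1 h)) (by linear_combination h2)
    simp [this.1, this.2] at h1
  have hv : v ≠ 0 := by
    rintro rfl
    have := eq_zero_of_prime_mul_sq_eq hp (u := w) (v := T) hpnB (by linear_combination -h4)
    simp [this.1, this.2] at h3
  have hT : T ≠ 0 := by
    rintro rfl
    have := eq_zero_of_prime_mul_sq_eq hl (u := v) (v := w) ndp (by linear_combination h4)
    exact hv this.1
  have hy' : (y : ℚ) ≠ 0 := by exact_mod_cast hy
  have hv' : (v : ℚ) ≠ 0 := by exact_mod_cast hv
  have hT' : (T : ℚ) ≠ 0 := by exact_mod_cast hT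
  have h2' : (s : ℚ) * x ^ 2 + l * y ^ 2 = z ^ 2 := by exact_mod_cast (by simpa using h2)
  have h4' : (B : ℚ) * T ^ 2 + l * v ^ 2 = p * w ^ 2 := by exact_mod_cast h4
  have hB' : (B : ℚ) + 1 = p * s * n ^ 2 := by exact_mod_cast hB
  -- The representation `l = (z/y)² - s (x/y)²` is scaled by `v/T` to match `l (v/T)² = p (w/T)² -
  -- B`.
  refine ⟨z * v / (y * T), x * v / (y * T), w / T, ?_⟩
  field_simp
  linear_combination - v ^ 2 * h2' + y ^ 2 * h4' - y ^ 2 * T ^ 2 * hB'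

theorem intCast_mem_normOneCoord {p s : ℕ} (hp : p.Prime) (hs : s.Prime) (hs4 : s % 4 = 1)
    (hsp : s ≠ p) {n : ℤ} (hn : 4 ∣ n) : (n : ℚ) ∈ normOneCoord p s := by
  rcases eq_or_ne n 0 with rfl | h0
  · exact ⟨1, 0, 0, by simp⟩
  · obtain ⟨x, y, w, h⟩ := natCast_mem_normOneCoord hp hs hs4 hsp
      (Int.natCast_dvd.1 hn) (Int.natAbs_pos.2 h0)
    refine ⟨x, y, w, ?_⟩
    rw [← h, Nat.cast_natAbs, Int.cast_abs, sq_abs]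

/-! ### Local behaviour of the norm form at p -/

/-- Odd squares are 1 modulo 8, and `1 - 5 ≡ 4`. Hence values of the binary form have even 2-adic
valuation, which is what makes 2 behave like an odd prime with `s` a nonresidue. -/
theorem sq_sub_mul_sq_mod_eight {s : ℕ} (hs : s % 8 = 5) (a b : ℤ) :
    (∃ c d, a = 2 * c ∧ b = 2 * d) ∨ (a ^ 2 - s * b ^ 2) % 2 = 1 ∨ (a ^ 2 - s * b ^ 2) % 8 = 4 := by
  obtain ⟨t, rfl⟩ : ∃ t, s = 8 * t + 5 := ⟨s / 8, by omega⟩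
  have odd_sq : ∀ i : ℤ, ∃ j, (2 * i + 1) ^ 2 = 8 * j + 1 := fun i => by
    obtain ⟨j, hj⟩ := Int.even_mul_succ_self i
    exact ⟨j, by linear_combination 4 * hj⟩
  push_cast
  obtain ⟨c, rfl | rfl⟩ := Int.even_or_odd' a <;> obtain ⟨d, rfl | rfl⟩ := Int.even_or_odd' b
  · exact Or.inl ⟨c, d, rfl, rfl⟩
  · right; left
    obtain ⟨j, hj⟩ := odd_sq d
    rw [hj, show (2 * c) ^ 2 - (8 * (t : ℤ) + 5) * (8 * j + 1) =
      2 * (2 * c ^ 2 - 32 * t * j - 4 * t - 20 * j - 3) + 1 by ring]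
    omega
  · right; left
    obtain ⟨j, hj⟩ := odd_sq c
    rw [hj, show 8 * j + 1 - (8 * (t : ℤ) + 5) * (2 * d) ^ 2 =
      2 * (4 * j - 16 * t * d ^ 2 - 10 * d ^ 2) + 1 by ring]
    omega
  · right; right
    obtain ⟨i, hi⟩ := odd_sq c
    obtain ⟨j, hj⟩ := odd_sq d
    rw [hi, hj, show 8 * i + 1 - (8 * (t : ℤ) + 5) * (8 * j + 1) =
      8 * (i - 8 * t * j - t - 5 * j - 1) + 4 by ring]
    omega

/-- The norm form is anisotropic at `p`. -/
theorem prime_dvd_of_sq_dvd {p s : ℕ} (hp : p.Prime)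
    (hs : (p = 2 ∧ s % 8 = 5) ∨ (p ≠ 2 ∧ ¬ IsSquare (s : ZMod p))) {x y w n m : ℤ}
    (h : x ^ 2 - s * y ^ 2 - p * w ^ 2 + p * s * n ^ 2 = m ^ 2) (hm : (p : ℤ) ^ 2 ∣ m) :
    (p : ℤ) ∣ x ∧ (p : ℤ) ∣ y ∧ (p : ℤ) ∣ w ∧ (p : ℤ) ∣ n := by
  rcases hs with ⟨rfl, hs⟩ | ⟨-, hs⟩
  -- For `p = 2` the contradiction appears only modulo 16, so `p ∣ m` would not be enough: with `s =
  -- 5` and `m = 2`, the vector `(1, 1, 1, 1)` is a solution.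
  · obtain ⟨k, rfl⟩ := hm
    have hQ : (x ^ 2 - s * y ^ 2) - 2 * (w ^ 2 - s * n ^ 2) = 16 * k ^ 2 := by
      push_cast at h; linear_combination h
    have quarter : ∀ c d : ℤ, (2 * c) ^ 2 - s * (2 * d) ^ 2 = 4 * (c ^ 2 - s * d ^ 2) := by
      intros; ring
    have hxy := sq_sub_mul_sq_mod_eight hs x y
    have hwn := sq_sub_mul_sq_mod_eight hs w n
    rcases hxy with ⟨x, y, rfl, rfl⟩ | hxy
    · rcases hwn with ⟨w, n, rfl, rfl⟩ | hwn
      · push_cast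
        exact ⟨Dvd.intro _ rfl, Dvd.intro _ rfl, Dvd.intro _ rfl, Dvd.intro _ rfl⟩
      · rw [quarter] at hQ
        rcases sq_sub_mul_sq_mod_eight hs x y with ⟨x, y, rfl, rfl⟩ | hxy
        · rw [quarter] at hQ
          omega
        · omega
    · rcases hwn with ⟨w, n, rfl, rfl⟩ | hwn
      · rw [quarter] at hQ
        omega
      · omega
  · have := Fact.mk hp
    have hpz : Prime (p : ℤ) := Nat.prime_iff_prime_int.1 hp
    have key : ∀ a b : ℤ, (p : ℤ) ∣ a ^ 2 - s * b ^ 2 → (p : ℤ) ∣ a ∧ (p : ℤ) ∣ b := by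
      intro a b hab
      rw [← ZMod.intCast_zmod_eq_zero_iff_dvd] at hab
      push_cast at hab
      have hb : (b : ZMod p) = 0 := by
        by_contra hb
        refine hs ⟨a / b, ?_⟩
        field_simp
        linear_combination -hab
      have ha : (a : ZMod p) = 0 := by simpa [hb] using hab
      exact ⟨(ZMod.intCast_zmod_eq_zero_iff_dvd _ _).1 ha,
        (ZMod.intCast_zmod_eq_zero_iff_dvd _ _).1 hb⟩
    obtain ⟨k, rfl⟩ := hm
    obtain ⟨⟨a, rfl⟩, ⟨b, rfl⟩⟩ := key x y
      ⟨p * (p * k) ^ 2 + w ^ 2 - s * n ^ 2, by linear_combination h⟩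
    refine ⟨Dvd.intro _ rfl, Dvd.intro _ rfl, key w n ⟨a ^ 2 - s * b ^ 2 - (p * k) ^ 2, ?_⟩⟩
    apply mul_left_cancel₀ hpz.ne_zero
    linear_combination -h

/-- Infinite descent: as long as `p²` divides `m`, all coordinates can be divided by `p`. The last
factor `p` of `m` cannot be used, whence the loss of one in the exponent. -/
theorem pow_dvd_of_pow_succ_dvd {p s : ℕ} (hp : p.Prime)
    (hs : (p = 2 ∧ s % 8 = 5) ∨ (p ≠ 2 ∧ ¬ IsSquare (s : ZMod p))) (k : ℕ) :
    ∀ {x y w n m : ℤ}, x ^ 2 - s * y ^ 2 - p * w ^ 2 + p * s * n ^ 2 = m ^ 2 →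
      (p : ℤ) ^ (k + 1) ∣ m → (p : ℤ) ^ k ∣ n := by
  have hp0 : (p : ℤ) ≠ 0 := by exact_mod_cast hp.ne_zero
  induction k with
  | zero => simp
  | succ k ih =>
    intro x y w n m h hm
    obtain ⟨⟨x, rfl⟩, ⟨y, rfl⟩, ⟨w, rfl⟩, ⟨n, rfl⟩⟩ :=
      prime_dvd_of_sq_dvd hp hs h ((pow_dvd_pow _ (by omega)).trans hm)
    obtain ⟨m, rfl⟩ : (p : ℤ) ∣ m := (dvd_pow_self _ (by omega)).trans hm
    rw [pow_succ'] at hm ⊢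
    refine mul_dvd_mul_left _ (ih (x := x) (y := y) (w := w) (m := m) ?_
      ((mul_dvd_mul_iff_left hp0).1 hm))
    apply mul_left_cancel₀ (pow_ne_zero 2 hp0)
    linear_combination h

/-- This says that `n` has p-adic valuation at least -1. It comes from clearing denominators with a
common `M` and letting the descent cancel all but one factor `p` of `M`. -/
theorem exists_eq_div_of_mem_normOneCoord {p s : ℕ} (hp : p.Prime)
    (hs : (p = 2 ∧ s % 8 = 5) ∨ (p ≠ 2 ∧ ¬ IsSquare (s : ZMod p))) {n : ℚ}
    (hn : n ∈ normOneCoord p s) : ∃ a b : ℤ, ¬ (p : ℤ) ∣ b ∧ n * (p * b) = a := by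
  obtain ⟨x, y, w, h⟩ := hn
  obtain ⟨M, hM0, X, Y, W, N, hX, hY, hW, hN⟩ : ∃ M : ℤ, M ≠ 0 ∧ ∃ X Y W N : ℤ,
      x * M = X ∧ y * M = Y ∧ w * M = W ∧ n * M = N := by
    refine ⟨x.den * y.den * w.den * n.den, by simp, x.num * y.den * w.den * n.den,
      y.num * x.den * w.den * n.den, w.num * x.den * y.den * n.den,
      n.num * x.den * y.den * w.den, ?_, ?_, ?_, ?_⟩ <;> push_cast
    · rw [← Rat.mul_den_eq_num x]; ring
    · rw [← Rat.mul_den_eq_num y]; ring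
    · rw [← Rat.mul_den_eq_num w]; ring
    · rw [← Rat.mul_den_eq_num n]; ring
  have hI : X ^ 2 - s * Y ^ 2 - p * W ^ 2 + p * s * N ^ 2 = M ^ 2 := by
    have : (X : ℚ) ^ 2 - s * Y ^ 2 - p * W ^ 2 + p * s * N ^ 2 = M ^ 2 := by
      rw [← hX, ← hY, ← hW, ← hN]; linear_combination M ^ 2 * h
    exact_mod_cast this
  have hfin : FiniteMultiplicity (p : ℤ) M :=
    Int.finiteMultiplicity_iff.2 ⟨by simpa using hp.one_lt.ne', hM0⟩
  obtain ⟨b, hb, hpb⟩ := hfin.exists_eq_pow_mul_and_not_dvd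
  generalize multiplicity (p : ℤ) M = j at hb
  rcases j with _ | k
  · exact ⟨p * N, b, hpb, by push_cast; rw [← hN, hb]; push_cast; ring⟩
  · obtain ⟨a, ha⟩ := pow_dvd_of_pow_succ_dvd hp hs k hI (hb ▸ Dvd.intro _ rfl)
    refine ⟨a, b, hpb, ?_⟩
    have hpk : (p : ℚ) ^ k ≠ 0 := pow_ne_zero _ (by exact_mod_cast hp.ne_zero)
    apply mul_left_cancel₀ hpk
    rw [ha, hb] at hN
    push_cast at hN
    linear_combination hN

/-! ### Diophantine definition of p-integrality -/

theorem exists_prime_mod_four_nonresidue {p : ℕ} (hp : p.Prime) : ∃ s : ℕ, s.Prime ∧ s % 4 = 1 ∧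
    s ≠ p ∧ ((p = 2 ∧ s % 8 = 5) ∨ (p ≠ 2 ∧ ¬ IsSquare (s : ZMod p))) := by
  have := Fact.mk hp
  by_cases h2 : p = 2
  · exact ⟨5, by norm_num, by norm_num, by omega, Or.inl ⟨h2, by norm_num⟩⟩
  · obtain ⟨a, ha⟩ := FiniteField.exists_nonsquare (F := ZMod p) (by rwa [ZMod.ringChar_zmod_n])
    obtain ⟨r, rfl⟩ := ZMod.natCast_zmod_surjective a
    have h4 : Nat.Coprime 4 p :=
      Nat.Coprime.pow_left 2 ((Nat.coprime_primes Nat.prime_two hp).2 (Ne.symm h2))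
    obtain ⟨t, ht1, ht2⟩ := Nat.chineseRemainder h4 1 r
    have hr : ¬ p ∣ r := fun h => ha (by rw [(ZMod.natCast_eq_zero_iff r p).2 h]; simp)
    have ht : t.Coprime (4 * p) := by
      refine Nat.Coprime.mul_right ?_ ?_
      · rw [Nat.Coprime, ht1.gcd_eq]; simp
      · rw [Nat.Coprime, ht2.gcd_eq]; exact ((Nat.Prime.coprime_iff_not_dvd hp).2 hr).symm
    obtain ⟨s, hsp, hs, hst⟩ :=
      Nat.forall_exists_prime_gt_and_modEq p (by have := hp.pos; omega : 4 * p ≠ 0) ht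
    refine ⟨s, hs, (hst.of_mul_right _).trans ht1, hsp.ne', Or.inr ⟨h2, ?_⟩⟩
    rwa [(ZMod.natCast_eq_natCast_iff s r p).2 ((hst.of_mul_left _).trans ht2)]

/-- Integrality at `p` in terms of `normOneCoord`. -/
theorem not_dvd_den_iff {p s : ℕ} (hp : p.Prime) (hs : s.Prime) (hs4 : s % 4 = 1) (hsp : s ≠ p)
    (hs' : (p = 2 ∧ s % 8 = 5) ∨ (p ≠ 2 ∧ ¬ IsSquare (s : ZMod p))) (x : ℚ) :
    ¬ p ∣ x.den ↔ ∃ g ∈ normOneCoord p s, ∃ h ∈ normOneCoord p s,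
      x ^ 4 * (4 + p ^ 4 * g) = h := by
  have hpz : Prime (p : ℤ) := Nat.prime_iff_prime_int.1 hp
  constructor
  · intro hx
    have hco : IsCoprime ((x.den ^ 4 : ℕ) : ℤ) ((p ^ 4 : ℕ) : ℤ) :=
      Nat.isCoprime_iff_coprime.2 (((Nat.Prime.coprime_iff_not_dvd hp).2 hx).symm.pow 4 4)
    obtain ⟨u, v, huv⟩ := hco
    -- From `u den⁴ + v p⁴ = 1` follows `4 - 4 v p⁴ = 4 u den⁴`; multiplying by `x⁴` leaves the
    -- integer `4 u num⁴`.
    refine ⟨((4 * -v : ℤ) : ℚ), intCast_mem_normOneCoord hp hs hs4 hsp (Dvd.intro _ rfl),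
      ((4 * (x.num ^ 4 * u) : ℤ) : ℚ), intCast_mem_normOneCoord hp hs hs4 hsp (Dvd.intro _ rfl), ?_⟩
    have huv' : (u : ℚ) * x.den ^ 4 + v * p ^ 4 = 1 := by exact_mod_cast huv
    push_cast
    rw [← Rat.mul_den_eq_num x]
    linear_combination -4 * x ^ 4 * huv'
  -- Valuation count: `p⁴ g` has valuation at least 3 and 4 has at most 2, so `4 + p⁴ g` has at most
  -- 2. If `p` divides the denominator of `x`, then `x⁴` has valuation at most -4, and `h` at most
  -- -2, below the permitted -1. In integers this ends in `p³ ∣ 4`.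
  · rintro ⟨g, hg, h, hh, e⟩ hx
    obtain ⟨G, m, hm, hG⟩ := exists_eq_div_of_mem_normOneCoord hp hs' hg
    obtain ⟨H, k, hk, hH⟩ := exists_eq_div_of_mem_normOneCoord hp hs' hh
    have e' : p * (x.num ^ 4 * k * (4 * m + p ^ 3 * G)) = H * m * x.den ^ 4 := by
      have : (p * (x.num ^ 4 * k * (4 * m + p ^ 3 * G)) : ℚ) = H * m * x.den ^ 4 := by
        rw [← Rat.mul_den_eq_num x, ← hG, ← hH, ← e]; ring
      exact_mod_cast this
    have hnum : ¬ (p : ℤ) ∣ x.num := fun h => by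
      have := Nat.dvd_gcd (Int.natCast_dvd.1 h) hx
      rw [x.reduced] at this
      exact hp.one_lt.ne' (Nat.dvd_one.1 this)
    have hpow : (p : ℤ) ^ 3 ∣ x.num ^ 4 * k * (4 * m + p ^ 3 * G) := by
      obtain ⟨d, hd⟩ := hx
      rw [hd] at e'
      refine ⟨H * m * d ^ 4, mul_left_cancel₀ hpz.ne_zero ?_⟩
      push_cast at e'; linear_combination e'
    have hn : ¬ (p : ℤ) ∣ x.num ^ 4 * k := by
      rw [hpz.dvd_mul]
      rintro (h | h)
      exacts [hnum (hpz.dvd_of_dvd_pow h), hk h]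
    have h4 := (dvd_add_left (Dvd.intro _ rfl)).1 (hpz.pow_dvd_of_dvd_mul_left 3 hn hpow)
    have h3 : p ^ 3 ∣ 4 := by exact_mod_cast hpz.pow_dvd_of_dvd_mul_right 3 hm h4
    have := Nat.le_of_dvd (by norm_num) h3
    have := Nat.pow_le_pow_left hp.two_le 3
    omega

/-! ### The rings R_W and Diophantine subsets of ℚ -/

theorem mem_primeInvRing_iff {W : Set Nat.Primes} {x : ℚ} :
    x ∈ primeInvRing W ↔ ∀ p : Nat.Primes, (p : ℕ) ∣ x.den → p ∈ W := by
  constructor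
  · intro hx
    induction hx using Subring.closure_induction with
    | mem x hx =>
      obtain ⟨q, hq, rfl⟩ := hx
      intro p hp
      have : (1 / ((q : ℕ) : ℚ)).den = q := by
        rw [one_div, Rat.inv_natCast_den_of_pos q.2.pos]
      rw [this, Nat.prime_dvd_prime_iff_eq p.2 q.2] at hp
      rwa [show p = q from Subtype.ext hp]
    | zero => intro p hp; exact absurd (Nat.dvd_one.1 hp) p.2.one_lt.ne'
    | one => intro p hp; exact absurd (Nat.dvd_one.1 hp) p.2.one_lt.ne'
    | add x y _ _ hx hy =>
      intro p hp
      rcases (Nat.Prime.dvd_mul p.2).1 (hp.trans (Rat.add_den_dvd x y)) with h | h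
      exacts [hx p h, hy p h]
    | neg x _ hx => intro p hp; exact hx p (by simpa using hp)
    | mul x y _ _ hx hy =>
      intro p hp
      rcases (Nat.Prime.dvd_mul p.2).1 (hp.trans (Rat.mul_den_dvd x y)) with h | h
      exacts [hx p h, hy p h]
  · intro h
    have inv_mem : ∀ n : ℕ, n ≠ 0 → (∀ p : Nat.Primes, (p : ℕ) ∣ n → p ∈ W) →
        (1 / (n : ℚ)) ∈ primeInvRing W := by
      intro n
      induction n using Nat.recOnMul with
      | zero => simp
      | one => intro _ _; simp
      | prime p hp =>
        intro _ h
        exact Subring.subset_closure ⟨⟨p, hp⟩, h ⟨p, hp⟩ dvd_rfl, rfl⟩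
      | mul a b ha hb =>
        intro h0 h
        have := mul_mem (ha (left_ne_zero_of_mul h0) fun p hp => h p (hp.mul_right b))
          (hb (right_ne_zero_of_mul h0) fun p hp => h p (hp.mul_left a))
        convert this using 1
        push_cast
        rw [one_div_mul_one_div]
    have := mul_mem (intCast_mem (primeInvRing W) x.num) (inv_mem x.den x.den_nz h)
    rwa [mul_one_div, Rat.num_div_den] at this

/-- `S` is the projection of the rational zero set of a polynomial over `ℤ`. -/
def IsDiophantineSet (S : Set ℚ) : Prop :=
  ∃ P : MvPolynomial ℕ ℤ, ∀ x, x ∈ S ↔ ∃ y : ℕ → ℚ, y 0 = x ∧ MvPolynomial.aeval y P = 0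

theorem IsDiophantineSet.inter {S T : Set ℚ} (hS : IsDiophantineSet S) (hT : IsDiophantineSet T) :
    IsDiophantineSet (S ∩ T) := by
  obtain ⟨P, hP⟩ := hS
  obtain ⟨Q, hQ⟩ := hT
  -- The two renamings separate all variables except index 0, which both fix: `2 * 0 - 1 = 0` by
  -- truncated subtraction. So the two systems share exactly the variable for `x`.
  refine ⟨MvPolynomial.rename (2 * ·) P ^ 2 +
    MvPolynomial.rename (fun j => 2 * j - 1) Q ^ 2, fun x => ?_⟩
  simp only [map_add, map_pow, MvPolynomial.aeval_rename, Set.mem_inter_iff, hP, hQ]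
  constructor
  · rintro ⟨⟨y, hy, h1⟩, z, hz, h2⟩
    refine ⟨fun j => if j % 2 = 0 then y (j / 2) else z ((j + 1) / 2), by simpa using hy, ?_⟩
    have e1 : (fun j => if j % 2 = 0 then y (j / 2) else z ((j + 1) / 2)) ∘ (2 * ·) = y := by
      ext j; simp
    have e2 : (fun j => if j % 2 = 0 then y (j / 2) else z ((j + 1) / 2)) ∘ (fun j => 2 * j - 1)
        = z := by
      ext j
      rcases j with _ | j
      · simp [hy, hz]
      · have : (2 * (j + 1) - 1) % 2 = 1 := by omega
        have h2 : (2 * (j + 1) - 1 + 1) / 2 = j + 1 := by omega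
        simp only [Function.comp, this, h2]; simp
    rw [e1, e2, h1, h2]; simp
  · rintro ⟨y, hy, h⟩
    rw [add_eq_zero_iff_of_nonneg (sq_nonneg _) (sq_nonneg _)] at h
    exact ⟨⟨y ∘ (2 * ·), by simpa using hy, pow_eq_zero_iff two_ne_zero |>.1 h.1⟩,
      ⟨y ∘ fun j => 2 * j - 1, by simpa using hy, pow_eq_zero_iff two_ne_zero |>.1 h.2⟩⟩

open MvPolynomial in
theorem isDiophantineSet_not_dvd_den {p : ℕ} (hp : p.Prime) :
    IsDiophantineSet {x | ¬ p ∣ x.den} := by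
  obtain ⟨s, hs, hs4, hsp, hs'⟩ := exists_prime_mod_four_nonresidue hp
  let N : ℕ → ℕ → ℕ → ℕ → MvPolynomial ℕ ℤ := fun a b c d =>
    X a ^ 2 - C (s : ℤ) * X b ^ 2 - C (p : ℤ) * X c ^ 2 + C (p : ℤ) * C (s : ℤ) * X d ^ 2 - 1
  -- Variables 0, 1, 2 stand for `x`, `g`, `h`; 3 to 5 and 6 to 8 are the remaining coordinates of
  -- the norm-one vectors for `g` and `h`.
  refine ⟨(X 0 ^ 4 * (4 + C (p : ℤ) ^ 4 * X 1) - X 2) ^ 2 + N 3 4 5 1 ^ 2 + N 6 7 8 2 ^ 2,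
    fun x => ?_⟩
  rw [Set.mem_ofPred_eq, not_dvd_den_iff hp hs hs4 hsp hs']
  have sum_sq : ∀ a b c : ℚ, a ^ 2 + b ^ 2 + c ^ 2 = 0 ↔ a = 0 ∧ b = 0 ∧ c = 0 := by
    intro a b c
    rw [add_eq_zero_iff_of_nonneg (by positivity) (by positivity),
      add_eq_zero_iff_of_nonneg (by positivity) (by positivity)]
    simp [and_assoc]
  simp only [N, map_add, map_sub, map_mul, map_pow, aeval_X, aeval_C, map_one, map_ofNat, sum_sq]
  simp only [sub_eq_zero, algebraMap_int_eq, eq_intCast, Int.cast_natCast]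
  constructor
  · rintro ⟨g, ⟨a, b, c, h1⟩, h, ⟨a', b', c', h2⟩, e⟩
    exact ⟨fun j => [x, g, h, a, b, c, a', b', c'].getD j 0, rfl, e, h1, h2⟩
  · rintro ⟨y, rfl, e, h1, h2⟩
    exact ⟨y 1, ⟨_, _, _, h1⟩, y 2, ⟨_, _, _, h2⟩, e⟩

theorem isDiophantineSet_primeInvRing {F : Set Nat.Primes} (hF : F.Finite) :
    IsDiophantineSet (primeInvRing Fᶜ) := by
  have : ∀ x, x ∈ primeInvRing Fᶜ ↔ ∀ p ∈ F, ¬ (p : ℕ) ∣ x.den := fun x => by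
    rw [mem_primeInvRing_iff]
    exact forall_congr' fun p => imp_not_comm
  rw [show ((primeInvRing Fᶜ : Subring ℚ) : Set ℚ) = {x | ∀ p ∈ F, ¬ (p : ℕ) ∣ x.den} from
    Set.ext this]
  induction F, hF using Set.Finite.induction_on with
  | empty => exact ⟨0, fun x => by simpa using ⟨fun _ => x, rfl⟩⟩
  | @insert p F _ _ ih =>
    have := (isDiophantineSet_not_dvd_den p.2).inter (ih ?_)
    · convert this using 1
      ext x; simp
    · intro x
      rw [mem_primeInvRing_iff]
      exact forall_congr' fun p => imp_not_comm

/-! ### The computable reduction of HTP(R) to HTP(ℚ) for Diophantine R -/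

theorem primrec_natCast_int : Primrec fun n : ℕ => (n : ℤ) := by
  refine Primrec.encode_iff.1 ((Primrec.nat_mul.comp (Primrec.const 2) Primrec.id).of_eq ?_)
  intro n
  rfl

theorem primrec_neg_natCast_int : Primrec fun n : ℕ => -(n : ℤ) := by
  have h : Primrec fun n : ℕ => Int.negSucc n := by
    refine Primrec.encode_iff.1
      ((Primrec.succ.comp (Primrec.nat_mul.comp (Primrec.const 2) Primrec.id)).of_eq ?_)
    intro n
    rfl
  refine (Primrec.nat_casesOn (f := id) (g := fun _ => (0 : ℤ)) (h := fun _ n => Int.negSucc n)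
    Primrec.id (Primrec.const 0) (h.comp Primrec.snd).to₂).of_eq fun n => ?_
  cases n <;> simp [Int.negSucc_eq]

/-- Split each factor into positive and negative part. Of the like-sign sum `A` and the mixed-sign
sum `B` at most one is nonzero, so the product is `A` if `B = 0` and `-B` otherwise. -/
theorem primrec_int_mul : Primrec₂ ((· * ·) : ℤ → ℤ → ℤ) := by
  have pos₁ := NumberingExists.primrec_toNat.comp (Primrec.fst (α := ℤ) (β := ℤ))
  have pos₂ := NumberingExists.primrec_toNat.comp (Primrec.snd (α := ℤ) (β := ℤ))
  have neg₁ := NumberingExists.primrec_neg_toNat.comp (Primrec.fst (α := ℤ) (β := ℤ))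
  have neg₂ := NumberingExists.primrec_neg_toNat.comp (Primrec.snd (α := ℤ) (β := ℤ))
  have hA := Primrec.nat_add.comp (Primrec.nat_mul.comp pos₁ pos₂) (Primrec.nat_mul.comp neg₁ neg₂)
  have hB := Primrec.nat_add.comp (Primrec.nat_mul.comp pos₁ neg₂) (Primrec.nat_mul.comp neg₁ pos₂)
  refine (Primrec.ite (Primrec.eq.comp hB (Primrec.const 0)) (primrec_natCast_int.comp hA)
    (primrec_neg_natCast_int.comp hB)).of_eq ?_
  rintro ⟨z, w⟩
  obtain ⟨a, rfl | rfl⟩ := z.eq_nat_or_neg <;> obtain ⟨b, rfl | rfl⟩ := w.eq_nat_or_neg <;>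
    simp

/-- Renaming the variables in a list of terms. -/
def renameTerms (ρ : ℕ → ℕ) (l : TermList) : TermList :=
  l.map fun t => (t.1, t.2.map ρ)

/-- A list of terms for the product. -/
def mulTerms (l k : TermList) : TermList :=
  l.flatMap fun a => k.map fun b => (a.1 * b.1, a.2 ++ b.2)

/-- Copies of the terms `k`, one for every occurrence of a variable in `l`, with separate variables
for separate `i`. -/
def copyTerms (k l : TermList) : TermList :=
  l.flatMap fun t => t.2.flatMap fun i => renameTerms (fun j => Nat.pair i j + 1) k

/-- Terms of `f² + ∑ᵢ P(X_{i,0}, X_{i,1}, …) + (X₀ + n)²`, where `f` is given by `l` in the variables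
`X_{i,0}` and `P` by `k`. -/
def reductionTerms (k : TermList) (n : ℕ) (l : TermList) : TermList :=
  mulTerms (renameTerms (fun i => Nat.pair i 0 + 1) l) (renameTerms (fun i => Nat.pair i 0 + 1) l) ++
    copyTerms k l ++ [(1, [0, 0]), (((2 * n : ℕ) : ℤ), [0]), (((n * n : ℕ) : ℤ), [])]

theorem aeval_polyOfTerms {A : Type*} [CommRing A] (y : ℕ → A) (l : TermList) :
    MvPolynomial.aeval y (polyOfTerms l) = (l.map fun t => (t.1 : A) * (t.2.map y).prod).sum := by
  simp [polyOfTerms, map_list_sum, map_list_prod, Function.comp_def]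

theorem aeval_polyOfTerms_append {A : Type*} [CommRing A] (y : ℕ → A) (l k : TermList) :
    MvPolynomial.aeval y (polyOfTerms (l ++ k)) =
      MvPolynomial.aeval y (polyOfTerms l) + MvPolynomial.aeval y (polyOfTerms k) := by
  simp [aeval_polyOfTerms]

theorem aeval_polyOfTerms_renameTerms {A : Type*} [CommRing A] (y : ℕ → A) (ρ : ℕ → ℕ)
    (l : TermList) : MvPolynomial.aeval y (polyOfTerms (renameTerms ρ l)) =
      MvPolynomial.aeval (y ∘ ρ) (polyOfTerms l) := by
  simp [aeval_polyOfTerms, renameTerms, Function.comp_def]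

theorem aeval_polyOfTerms_mulTerms {A : Type*} [CommRing A] (y : ℕ → A) (l k : TermList) :
    MvPolynomial.aeval y (polyOfTerms (mulTerms l k)) =
      MvPolynomial.aeval y (polyOfTerms l) * MvPolynomial.aeval y (polyOfTerms k) := by
  simp only [aeval_polyOfTerms, mulTerms]
  induction l with
  | nil => simp
  | cons a l ih =>
    simp only [List.flatMap_cons, List.map_append, List.sum_append, ih, List.map_cons,
      List.sum_cons, add_mul, List.map_map]
    congr 1
    rw [← List.sum_map_mul_left]
    congr 2
    funext b
    simp; ring

theorem aeval_polyOfTerms_copyTerms {A : Type*} [CommRing A] (y : ℕ → A) (k l : TermList) :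
    MvPolynomial.aeval y (polyOfTerms (copyTerms k l)) =
      ((l.flatMap Prod.snd).map fun i =>
        MvPolynomial.aeval (fun j => y (Nat.pair i j + 1)) (polyOfTerms k)).sum := by
  have h : copyTerms k l = (l.flatMap Prod.snd).flatMap
      fun i => renameTerms (fun j => Nat.pair i j + 1) k := by
    rw [copyTerms, List.flatMap_assoc]
  rw [h]
  induction l.flatMap Prod.snd with
  | nil => simp [aeval_polyOfTerms]
  | cons i m ih =>
    rw [List.flatMap_cons, aeval_polyOfTerms_append, ih, aeval_polyOfTerms_renameTerms]
    rfl

theorem aeval_polyOfTerms_reductionTerms {A : Type*} [CommRing A] (y : ℕ → A) (k : TermList)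
    (n : ℕ) (l : TermList) : MvPolynomial.aeval y (polyOfTerms (reductionTerms k n l)) =
      MvPolynomial.aeval (fun i => y (Nat.pair i 0 + 1)) (polyOfTerms l) ^ 2 +
      ((l.flatMap Prod.snd).map fun i =>
        MvPolynomial.aeval (fun j => y (Nat.pair i j + 1)) (polyOfTerms k)).sum +
      (y 0 + n) ^ 2 := by
  rw [reductionTerms, aeval_polyOfTerms_append, aeval_polyOfTerms_append,
    aeval_polyOfTerms_mulTerms, aeval_polyOfTerms_renameTerms, aeval_polyOfTerms_copyTerms, ← sq]
  congr 1
  simp [aeval_polyOfTerms]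
  ring

theorem primrec_renameTerms {α : Type*} [Primcodable α] {ρ : α → ℕ → ℕ} {f : α → TermList}
    (hρ : Primrec₂ ρ) (hf : Primrec f) : Primrec fun a => renameTerms (ρ a) (f a) := by
  have h : Primrec fun q : α × (ℤ × List ℕ) => q.2.2.map (ρ q.1) :=
    Primrec.list_map (Primrec.snd.comp Primrec.snd)
      (hρ.comp (Primrec.fst.comp Primrec.fst) Primrec.snd)
  exact Primrec.list_map hf (Primrec.pair (Primrec.fst.comp Primrec.snd) h)

theorem primrec_mulTerms : Primrec₂ mulTerms := by
  have a := Primrec.snd.comp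
    (Primrec.fst (α := (TermList × TermList) × (ℤ × List ℕ)) (β := ℤ × List ℕ))
  have b := Primrec.snd (α := (TermList × TermList) × (ℤ × List ℕ)) (β := ℤ × List ℕ)
  have h : Primrec fun q : (TermList × TermList) × (ℤ × List ℕ) =>
      q.1.2.map fun b => (q.2.1 * b.1, q.2.2 ++ b.2) :=
    Primrec.list_map (Primrec.snd.comp Primrec.fst)
      (Primrec.pair (primrec_int_mul.comp (Primrec.fst.comp a) (Primrec.fst.comp b))
        (Primrec.list_append.comp (Primrec.snd.comp a) (Primrec.snd.comp b)))
  exact Primrec.list_flatMap (f := fun q : TermList × TermList => q.1) Primrec.fst h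

theorem primrec_copyTerms (k : TermList) : Primrec (copyTerms k) := by
  have h : Primrec fun i => renameTerms (fun j => Nat.pair i j + 1) k :=
    primrec_renameTerms (ρ := fun i j => Nat.pair i j + 1)
      (Primrec.succ.comp₂ Primrec₂.natPair) (Primrec.const k)
  have h' : Primrec fun q : TermList × (ℤ × List ℕ) =>
      q.2.2.flatMap fun i => renameTerms (fun j => Nat.pair i j + 1) k :=
    Primrec.list_flatMap (Primrec.snd.comp Primrec.snd) (h.comp Primrec.snd)
  exact Primrec.list_flatMap Primrec.id h'

theorem primrec_reductionTerms (k : TermList) : Primrec₂ (reductionTerms k) := by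
  have hr : Primrec fun l => renameTerms (fun i => Nat.pair i 0 + 1) l :=
    primrec_renameTerms (ρ := fun _ i => Nat.pair i 0 + 1)
      (Primrec.succ.comp (Primrec₂.natPair.comp Primrec.snd (Primrec.const 0))).to₂ Primrec.id
  have hr' := hr.comp (Primrec.snd (α := ℕ) (β := TermList))
  have h1 := primrec_natCast_int.comp
    (Primrec.nat_mul.comp (Primrec.const 2) (Primrec.fst (α := ℕ) (β := TermList)))
  have h2 := primrec_natCast_int.comp
    (Primrec.nat_mul.comp Primrec.fst (Primrec.fst (α := ℕ) (β := TermList)))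
  refine Primrec.list_append.comp (Primrec.list_append.comp (primrec_mulTerms.comp hr' hr')
    ((primrec_copyTerms k).comp Primrec.snd)) ?_
  exact Primrec.list_cons.comp (Primrec.const _) (Primrec.list_cons.comp
    (Primrec.pair h1 (Primrec.const _)) (Primrec.list_cons.comp
    (Primrec.pair h2 (Primrec.const _)) (Primrec.const [])))

theorem aeval_subring_coe (R : Subring ℚ) (x : ℕ → R) (f : MvPolynomial ℕ ℤ) :
    MvPolynomial.aeval (fun i => (x i : ℚ)) f = ((MvPolynomial.aeval x f : R) : ℚ) :=
  MvPolynomial.aeval_algebraMap_apply ℚ x f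

/-- Over `ℚ` a sum of nonnegative terms vanishes only if each does: thus `f` vanishes at the
`X_{i,0}`, and the copy of `P` for each occurring variable certifies that its value lies in `R`. The
term `(X₀ + n)²` is always solvable and does not affect membership. -/
theorem reductionTerms_mem_HTP_iff {R : Subring ℚ} {k : TermList}
    (hk : ∀ x, x ∈ R ↔ ∃ y : ℕ → ℚ, y 0 = x ∧ MvPolynomial.aeval y (polyOfTerms k) = 0)
    (hk0 : ∀ y : ℕ → ℚ, 0 ≤ MvPolynomial.aeval y (polyOfTerms k)) (n : ℕ) (l : TermList) :
    polyOfTerms (reductionTerms k n l) ∈ HTP ℚ ↔ polyOfTerms l ∈ HTP R := by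
  constructor
  · rintro ⟨y, hy⟩
    rw [aeval_polyOfTerms_reductionTerms] at hy
    have hsum : ∀ q ∈ ((l.flatMap Prod.snd).map fun i =>
        MvPolynomial.aeval (fun j => y (Nat.pair i j + 1)) (polyOfTerms k)), 0 ≤ q := by
      intro q hq
      obtain ⟨i, -, rfl⟩ := List.mem_map.1 hq
      exact hk0 _
    have hsum' := List.sum_nonneg hsum
    rw [add_eq_zero_iff_of_nonneg (by positivity) (by positivity),
      add_eq_zero_iff_of_nonneg (by positivity) hsum'] at hy
    obtain ⟨⟨h1, h2⟩, -⟩ := hy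
    replace h1 := (pow_eq_zero_iff two_ne_zero).1 h1
    have hmem : ∀ t ∈ l, ∀ i ∈ t.2, y (Nat.pair i 0 + 1) ∈ R := fun t ht i hi =>
      (hk _).2 ⟨fun j => y (Nat.pair i j + 1), rfl,
        List.all_zero_of_le_zero_le_of_sum_eq_zero hsum h2
          (List.mem_map.2 ⟨i, List.mem_flatMap.2 ⟨t, ht, hi⟩, rfl⟩)⟩
    classical
    -- Only variables occurring in `l` are certified to lie in `R`; the others get the harmless
    -- value 0.
    refine ⟨fun i => if h : y (Nat.pair i 0 + 1) ∈ R then ⟨_, h⟩ else 0, Subtype.ext ?_⟩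
    rw [← aeval_subring_coe, ZeroMemClass.coe_zero, ← h1,
      aeval_polyOfTerms, aeval_polyOfTerms]
    refine congrArg List.sum (List.map_congr_left fun t ht => ?_)
    refine congrArg (fun m : List ℚ => (t.1 : ℚ) * m.prod) (List.map_congr_left fun i hi => ?_)
    rw [dif_pos (hmem t ht i hi)]
  · rintro ⟨x, hx⟩
    choose Y hY0 hY using fun i => (hk _).1 (x i).2
    refine ⟨fun m => m.casesOn (-(n : ℚ)) fun q => Y q.unpair.1 q.unpair.2, ?_⟩
    rw [aeval_polyOfTerms_reductionTerms]
    simp [hY, hY0, aeval_subring_coe, hx]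

/-- The code `n` can be read off the polynomial: raising `X₀` from 0 to 1, with all other variables
0, changes the value by `2n + 1`, because `X₀` occurs only in `(X₀ + n)²`. -/
theorem reductionTerms_injective {k : TermList} {n n' : ℕ} {l l' : TermList}
    (h : polyOfTerms (reductionTerms k n l) = polyOfTerms (reductionTerms k n' l')) : n = n' := by
  have h0 := congrArg (MvPolynomial.aeval fun m : ℕ => if m = 0 then (0 : ℤ) else 0) h
  have h1 := congrArg (MvPolynomial.aeval fun m : ℕ => if m = 0 then (1 : ℤ) else 0) h
  simp only [aeval_polyOfTerms_reductionTerms, Nat.succ_ne_zero, if_true, if_false] at h0 h1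
  have : (n : ℤ) = n' := by linarith
  exact_mod_cast this

theorem oneOneReducible_HTPCodes {e : ℕ ≃ MvPolynomial ℕ ℤ} (he : IsComputableNumbering e)
    {R : Subring ℚ} (hR : IsDiophantineSet R) :
    OneOneReducible (fun n => n ∈ HTPCodes e R) (fun n => n ∈ HTPCodes e ℚ) := by
  obtain ⟨P, hP⟩ := hR
  -- Squaring `P` keeps its zeros and makes it nonnegative, so that its copies can simply be added.
  obtain ⟨k, hk⟩ := NumberingExists.poly_surjective (P ^ 2)
  obtain ⟨⟨g, hg, hge⟩, hs⟩ := he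
  refine ⟨fun n => e.symm (polyOfTerms (reductionTerms k n (g n))),
    hs.comp ((primrec_reductionTerms k).to_comp.comp Computable.id hg), fun n n' h =>
      reductionTerms_injective (e.symm.injective h), fun n => ?_⟩
  simp only [HTPCodes, Set.mem_ofPred_eq, Equiv.apply_symm_apply]
  rw [reductionTerms_mem_HTP_iff (R := R) _ _ n (g n), hge]
  · intro x
    simpa [hk] using hP x
  · intro y
    rw [hk, map_pow]
    positivity

/-! ### Monotonicity and finite use of primes -/

theorem primeInvRing_mono {V W : Set Nat.Primes} (h : V ⊆ W) : primeInvRing V ≤ primeInvRing W :=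
  Subring.closure_mono fun _ ⟨p, hp, hq⟩ => ⟨p, h hp, hq⟩

theorem HTP_mono {R S : Subring ℚ} (h : R ≤ S) : HTP R ⊆ HTP S := by
  rintro f ⟨x, hx⟩
  refine ⟨fun i => ⟨x i, h (x i).2⟩, Subtype.ext ?_⟩
  rw [← aeval_subring_coe, ZeroMemClass.coe_zero]
  exact (aeval_subring_coe R x f).trans (by rw [hx]; rfl)

/-- A zero of a polynomial in `R_W` lies in `R_S` for a finite subset `S` of `W`. -/
theorem exists_finite_mem_HTP {W : Set Nat.Primes} {f : MvPolynomial ℕ ℤ}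
    (hf : f ∈ HTP (primeInvRing W)) :
    ∃ S ⊆ W, S.Finite ∧ f ∈ HTP (primeInvRing S) := by
  obtain ⟨x, hx⟩ := hf
  let S : Set Nat.Primes := ⋃ i ∈ f.vars, {p | (p : ℕ) ∣ (x i : ℚ).den}
  have hS : ∀ i ∈ f.vars, (x i : ℚ) ∈ primeInvRing S := fun i hi =>
    mem_primeInvRing_iff.2 fun p hp => Set.mem_biUnion hi hp
  refine ⟨S, ?_, ?_, ?_⟩
  · refine Set.iUnion₂_subset fun i _ p hp => mem_primeInvRing_iff.1 (x i).2 p hp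
  · refine Set.Finite.biUnion f.vars.finite_toSet fun i _ => ?_
    refine Set.Finite.of_finite_image (f := fun p : Nat.Primes => (p : ℕ)) ?_
      Subtype.coe_injective.injOn
    refine (Set.finite_Iic (x i : ℚ).den).subset ?_
    rintro _ ⟨p, hp, rfl⟩
    exact Nat.le_of_dvd (x i : ℚ).den_pos hp
  · classical
    -- Coordinates that do not occur in `f` may have denominators outside `S`; they are replaced by
    -- 0.
    refine ⟨fun i => if h : (x i : ℚ) ∈ primeInvRing S then ⟨_, h⟩ else 0,
      Subtype.ext ?_⟩
    rw [← aeval_subring_coe, ZeroMemClass.coe_zero]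
    have h0 := (aeval_subring_coe _ x f).trans (by rw [hx]; rfl : _ = (0 : ℚ))
    rw [← h0]
    refine MvPolynomial.eval₂Hom_congr' rfl (fun i hi _ => ?_) rfl
    rw [dif_pos (hS i hi)]

/-! ### Cylinders in 2^ℙ and the category argument -/

theorem nthPrime_injective : Function.Injective nthPrime := fun _ _ h =>
  Nat.nth_injective Nat.infinite_setOfPred_prime (congrArg Subtype.val h)

theorem nthPrime_surjective : Function.Surjective nthPrime := fun p =>
  ⟨Nat.count Nat.Prime p, Subtype.ext (Nat.nth_count p.2)⟩

theorem finite_excludedPrimes (σ : List Bool) : (excludedPrimes σ).Finite := by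
  refine ((Set.finite_Iio σ.length).image nthPrime).subset ?_
  rintro _ ⟨i, h, rfl, -⟩
  exact ⟨i, h, rfl⟩

theorem primeSet_subset_of_mem_cylinder {σ : List Bool} {W : PrimeSetSpace} (hW : W ∈ cylinder σ) :
    primeSet W ⊆ (excludedPrimes σ)ᶜ := by
  rintro _ hp ⟨i, h, rfl, hi⟩
  have := hW i h
  rw [hi] at this
  exact Bool.noConfusion (this.symm.trans hp)

theorem isOpen_setOf_apply_eq (p : Nat.Primes) (b : Bool) :
    IsOpen {W : PrimeSetSpace | W p = b} := by
  have h : IsOpen ((fun W : PrimeSetSpace => W p) ⁻¹' {b}) :=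
    (isOpen_discrete {b}).preimage (continuous_apply p)
  exact h

/-- A finite set of conditions on a point of `2^ℙ` is open. -/
theorem isOpen_eqOn_finite {S : Set Nat.Primes} (hS : S.Finite) (V : PrimeSetSpace) :
    IsOpen {W : PrimeSetSpace | ∀ p ∈ S, W p = V p} := by
  have : {W : PrimeSetSpace | ∀ p ∈ S, W p = V p} = ⋂ p ∈ S, {W | W p = V p} := by
    ext; simp
  rw [this]
  exact hS.isOpen_biInter fun p _ => isOpen_setOf_apply_eq p (V p)

theorem exists_cylinder_subset {U : Set PrimeSetSpace} (hU : IsOpen U) (hne : U.Nonempty) :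
    ∃ σ, cylinder σ ⊆ U := by
  obtain ⟨V, hV⟩ := hne
  obtain ⟨I, u, hu, hIU⟩ := isOpen_pi_iff.1 hU V hV
  obtain ⟨N, hN⟩ : ∃ N, ∀ p ∈ I, ∃ i < N, nthPrime i = p := by
    choose c hc using nthPrime_surjective
    exact ⟨I.sup c + 1, fun p hp => ⟨c p, Nat.lt_succ_of_le (Finset.le_sup hp), hc p⟩⟩
  refine ⟨(List.range N).map fun i => V (nthPrime i), fun W hW => hIU fun p hp => ?_⟩
  obtain ⟨i, hi, rfl⟩ := hN p hp
  have := hW i (by simpa using hi)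
  simp only [List.getElem_map, List.getElem_range] at this
  rw [this]
  exact (hu _ hp).2

theorem cylinder_nonempty (σ : List Bool) : (cylinder σ).Nonempty := by
  choose c hc using nthPrime_surjective
  refine ⟨fun p => σ.getD (c p) false, fun i h => ?_⟩
  have : c (nthPrime i) = i := nthPrime_injective (hc _)
  simp [this, h]

theorem isOpen_cylinder (σ : List Bool) : IsOpen (cylinder σ) := by
  have : cylinder σ = ⋂ i : Fin σ.length, {W | W (nthPrime i) = σ[i]} := by
    ext W
    simp [cylinder, Fin.forall_iff]
  rw [this]
  exact isOpen_iInter_of_finite fun i => isOpen_setOf_apply_eq _ _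

/-- `HTP(R_W)` grows with `W`, and each membership depends on finitely many primes of `W`. The ring
at the top of the cylinder is thus approximated, one polynomial at a time, by those `W` in the
cylinder for which `φ` is a reduction. -/
theorem isOneReduction_of_cylinder_subset_closure (e : ℕ ≃ MvPolynomial ℕ ℤ) {C : Set ℕ}
    {φ : ℕ → ℕ} {σ : List Bool}
    (h : cylinder σ ⊆ closure {W : PrimeSetSpace |
      IsOneReduction φ C (HTPCodes e (primeInvRing (primeSet W)))}) :
    IsOneReduction φ C (HTPCodes e (primeInvRing (excludedPrimes σ)ᶜ)) := by
  have meets : ∀ U, IsOpen U → (U ∩ cylinder σ).Nonempty → ∃ W ∈ U, W ∈ cylinder σ ∧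
      IsOneReduction φ C (HTPCodes e (primeInvRing (primeSet W))) := by
    rintro U hU ⟨V, hV⟩
    obtain ⟨W, hW, hr⟩ := mem_closure_iff.1 (h hV.2) _ (hU.inter (isOpen_cylinder σ)) hV
    exact ⟨W, hW.1, hW.2, hr⟩
  -- A single such `W₀` already gives computability, injectivity and, by monotonicity, the forward
  -- implication.
  obtain ⟨W₀, -, hW₀, hc, hinj, hred⟩ := meets Set.univ isOpen_univ
    (by simpa using cylinder_nonempty σ)
  refine ⟨hc, hinj, fun n => ⟨fun hn => ?_, fun hn => ?_⟩⟩
  · exact HTP_mono (primeInvRing_mono (primeSet_subset_of_mem_cylinder hW₀)) ((hred n).1 hn)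
  · obtain ⟨S, hSσ, hS, hf⟩ := exists_finite_mem_HTP hn
    classical
    obtain ⟨W, hWS, -, -, -, hW⟩ := meets {W | ∀ p ∈ S, W p = true}
      (isOpen_eqOn_finite hS fun _ => true)
      -- The largest member of the cylinder shows that requiring the primes of `S` is compatible
      -- with `σ`.
      ⟨fun p => decide (p ∉ excludedPrimes σ), fun p hp => by simpa using hSσ hp, fun i hi => by
        cases hσ : σ[i]
        · simpa using ⟨i, hi, rfl, hσ⟩
        · simp only [decide_eq_true_eq]
          rintro ⟨j, hj, hij, hf⟩
          obtain rfl := nthPrime_injective hij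
          simp [hσ] at hf⟩
    exact (hW n).2 (HTP_mono (primeInvRing_mono fun p hp => hWS p hp) hf)

theorem countable_setOf_computable : {φ : ℕ → ℕ | Computable φ}.Countable := by
  have hcode : ∀ φ : {φ : ℕ → ℕ | Computable φ}, ∃ c : Nat.Partrec.Code,
      c.eval = fun n => Part.some (φ.1 n) := fun φ =>
    Nat.Partrec.Code.exists_code.1 (Partrec.nat_iff.1 φ.2)
  choose c hc using hcode
  refine Set.countable_coe_iff.1 (Function.Injective.countable (f := c) fun φ ψ h => ?_)
  refine Subtype.ext (funext fun n => Part.some_injective ?_)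
  exact congrFun ((hc φ).symm.trans (h ▸ hc ψ)) n

theorem theorem4p1 (e : ℕ ≃ MvPolynomial ℕ ℤ) (he : IsComputableNumbering e) (C : Set ℕ) :
    (¬ OneOneReducible (fun n => n ∈ C) (fun n => n ∈ HTPCodes e ℚ) →
      IsMeagre {W : PrimeSetSpace |
        OneOneReducible (fun n => n ∈ C)
          (fun n => n ∈ HTPCodes e (primeInvRing (primeSet W)))}) ∧
    (∀ (φ : ℕ → ℕ) (σ : List Bool),
      cylinder σ ⊆ closure {W : PrimeSetSpace |
        IsOneReduction φ C (HTPCodes e (primeInvRing (primeSet W)))} →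
      IsOneReduction φ C (HTPCodes e (primeInvRing (excludedPrimes σ)ᶜ))) := by
  refine ⟨fun hC => ?_, fun φ σ h => isOneReduction_of_cylinder_subset_closure e h⟩
  have hsub : {W : PrimeSetSpace | OneOneReducible (fun n => n ∈ C)
      (fun n => n ∈ HTPCodes e (primeInvRing (primeSet W)))} ⊆
      ⋃ φ ∈ {φ : ℕ → ℕ | Computable φ}, {W : PrimeSetSpace |
        IsOneReduction φ C (HTPCodes e (primeInvRing (primeSet W)))} := by
    rintro W ⟨φ, hφ⟩
    exact Set.mem_biUnion hφ.1 hφ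
  refine IsMeagre.mono hsub
    (isMeagre_biUnion countable_setOf_computable fun φ _ => IsNowhereDense.isMeagre ?_)
  -- Failure of nowhere density means that the closure has nonempty interior, hence contains a
  -- cylinder.
  by_contra hne
  obtain ⟨σ, hσ⟩ := exists_cylinder_subset isOpen_interior (Set.nonempty_iff_ne_empty.2 hne)
  obtain ⟨hc, hi, hr⟩ :=
    isOneReduction_of_cylinder_subset_closure e (hσ.trans interior_subset)
  have h1 : OneOneReducible (fun n => n ∈ C)
      (fun n => n ∈ HTPCodes e (primeInvRing (excludedPrimes σ)ᶜ)) := ⟨φ, hc, hi, hr⟩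
  exact hC (h1.trans (oneOneReducible_HTPCodes he
    (isDiophantineSet_primeInvRing (finite_excludedPrimes σ))))
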